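/- Let $R$ be a commutative noetherian local ring with residue field $k$. For finitely generated $R$-modules $X,Y$ let $\underline{\operatorname{Hom}}_R(X,Y)$ be the quotient of $\operatorname{Hom}_R(X,Y)$ by the submodule of homomorphisms that factor through a projective module. For every finitely generated $R$-module $X$ choose a surjection $P_X\to X$ from a finitely generated projective module, and let the syzygy $\Omega X$ be its kernel; lifting a homomorphism $X\to Y$ to $P_X\to P_Y$ and restricting the lift to the kernels gives a well-defined map $\Omega\colon\underline{\operatorname{Hom}}_R(X,Y)\to\underline{\operatorname{Hom}}_R(\Omega X,\Omega Y)$. Iterating this $n\ge 0$ times gives $\Omega^n\colon\underline{\operatorname{Hom}}_R(X,Y)\to\underline{\operatorname{Hom}}_R(\Omega^nX,\Omega^nY)$ (the identity for $n=0$). For a finitely generated $R$-module $M$ and $n\ge 0$, the $n$-th approximated $\xi$-invariant of $M$ is $$\xi_R(n,M)=\dim_k\operatorname{Ker}\bigl(\operatorname{Hom}_R(M,k)\twoheadrightarrow\underline{\operatorname{Hom}}_R(M,k)\xrightarrow{\Omega^n}\underline{\operatorname{Hom}}_R(\Omega^nM,\Omega^nk)\bigr).$$ Let $M$ be a finitely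 generated $R$-module and $n\ge 0$ an integer. Then, for every choice of the surjections $P_X\to X$, the following hold. (1) Let $a,b$ be integers with $0<a\le b$. If $\operatorname{Ext}^i_R(M,R)=0$ for all $a\le i\le b$, then $$\xi_R(a-1,M)=\xi_R(a,M)=\cdots=\xi_R(b-1,M)=\xi_R(b,M).$$ (2) If $\operatorname{Ext}^i_R(M,R)=0$ for all $1\le i\le n$, then for every $0\le j\le n$ the number $\xi_R(j,M)$ is the rank of the largest free summand of $M$, that is, the largest rank of a free module that is a direct summand of $M$. -/

import Mathlib

universe u

namespace StableXi

open CategoryTheory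

/-- `𝒫(X, Y)`: the submodule of `Hom_R(X, Y)` of the homomorphisms that factor through some
projective module. -/
def projectiveMaps (R : Type u) [CommRing R] (X Y : Type u) [AddCommGroup X] [Module R X]
    [AddCommGroup Y] [Module R Y] : Submodule R (X →ₗ[R] Y) where
  carrier := {f | ∃ (Q : Type u) (_ : AddCommGroup Q) (_ : Module R Q) (_ : Module.Projective R Q)
    (p : X →ₗ[R] Q) (q : Q →ₗ[R] Y), q ∘ₗ p = f}
  zero_mem' := ⟨PUnit, inferInstance, inferInstance, inferInstance, 0, 0, by simp⟩
  add_mem' := by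
    rintro f g ⟨Q, _, _, _, p, q, rfl⟩ ⟨Q', _, _, _, p', q', rfl⟩
    exact ⟨Q × Q', inferInstance, inferInstance, inferInstance, p.prod p', q.coprod q',
      by ext x; simp⟩
  smul_mem' := by
    rintro r f ⟨Q, _, _, _, p, q, rfl⟩
    exact ⟨Q, inferInstance, inferInstance, inferInstance, p, r • q, by ext x; simp⟩

/-- The stable Hom module: `Hom_R(X, Y)` modulo the maps that factor through a projective module. -/
abbrev StableHom (R : Type u) [CommRing R] (X Y : Type u) [AddCommGroup X] [Module R X]
    [AddCommGroup Y] [Module R Y] : Type u :=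
  (X →ₗ[R] Y) ⧸ projectiveMaps R X Y

/-- A choice, for every finitely generated module `M`, of a finitely generated projective module
`P M` with a surjection `π M : P M → M`. (Over a noetherian ring this is the same as the beginning
of a finite projective presentation `P₁ → P₀ → M → 0`; the image of `P₁ → P₀` is the kernel of
`P₀ → M`.) Syzygies depend on such a choice only up to projective summands. -/
structure SyzygyChoice (R : Type u) [CommRing R] where
  P : FGModuleCat.{u} R → FGModuleCat.{u} R
  projective : ∀ M, Module.Projective R (P M)
  π : ∀ M : FGModuleCat.{u} R, P M →ₗ[R] M
  surjective : ∀ M, Function.Surjective (π M)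

/-- Such choices exist. -/
instance (R : Type u) [CommRing R] : Nonempty (SyzygyChoice R) := by
  have h (M : FGModuleCat.{u} R) : ∃ (n : ℕ) (f : (Fin n → R) →ₗ[R] M), Function.Surjective f :=
    Module.Finite.exists_fin' R M
  choose n f hf using h
  exact ⟨{ P := fun M => FGModuleCat.of R (Fin (n M) → R)
           projective := fun M => inferInstanceAs (Module.Projective R (Fin (n M) → R))
           π := fun M => f M
           surjective := hf }⟩

namespace SyzygyChoice

variable {R : Type u} [CommRing R] (σ : SyzygyChoice R)

theorem exists_lift {M N : FGModuleCat.{u} R} (f : M →ₗ[R] N) :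
    ∃ g : σ.P M →ₗ[R] σ.P N, σ.π N ∘ₗ g = f ∘ₗ σ.π M :=
  haveI := σ.projective M
  Module.projective_lifting_property (σ.π N) (f ∘ₗ σ.π M) (σ.surjective N)

/-- A lift of `f : M → N` to the chosen projective modules. -/
noncomputable def lift {M N : FGModuleCat.{u} R} (f : M →ₗ[R] N) : σ.P M →ₗ[R] σ.P N :=
  (σ.exists_lift f).choose

theorem lift_spec {M N : FGModuleCat.{u} R} (f : M →ₗ[R] N) :
    σ.π N ∘ₗ σ.lift f = f ∘ₗ σ.π M :=
  (σ.exists_lift f).choose_spec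

theorem mapsTo_ker {M N : FGModuleCat.{u} R} {f : M →ₗ[R] N} {g : σ.P M →ₗ[R] σ.P N}
    (hg : σ.π N ∘ₗ g = f ∘ₗ σ.π M) :
    ∀ x ∈ LinearMap.ker (σ.π M), g x ∈ LinearMap.ker (σ.π N) := by
  intro x hx
  have h := LinearMap.congr_fun hg x
  simp only [LinearMap.comp_apply] at h
  rw [LinearMap.mem_ker] at hx ⊢
  rw [h, hx, map_zero]

/-- Two lifts of the same map induce the same stable map on the kernels. -/
theorem restrict_sub_mem {M N : FGModuleCat.{u} R} {f : M →ₗ[R] N} {g g' : σ.P M →ₗ[R] σ.P N}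
    (hg : σ.π N ∘ₗ g = f ∘ₗ σ.π M) (hg' : σ.π N ∘ₗ g' = f ∘ₗ σ.π M) :
    g.restrict (σ.mapsTo_ker hg) - g'.restrict (σ.mapsTo_ker hg') ∈
      projectiveMaps R (LinearMap.ker (σ.π M)) (LinearMap.ker (σ.π N)) := by
  refine ⟨σ.P M, inferInstance, inferInstance, σ.projective M, (LinearMap.ker (σ.π M)).subtype,
    (g - g').codRestrict (LinearMap.ker (σ.π N)) ?_, ?_⟩
  · intro x
    have h := LinearMap.congr_fun (hg.trans hg'.symm) x
    simp only [LinearMap.comp_apply] at h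
    simp [h]
  · ext x
    simp

/-- The class of the map on kernels induced by any lift, as a linear map out of `Hom_R(M, N)`. -/
noncomputable def syzygyMapAux (M N : FGModuleCat.{u} R) :
    (M →ₗ[R] N) →ₗ[R] StableHom R (LinearMap.ker (σ.π M)) (LinearMap.ker (σ.π N)) where
  toFun f := Submodule.Quotient.mk ((σ.lift f).restrict (σ.mapsTo_ker (σ.lift_spec f)))
  map_add' f f' := by
    have h : σ.π N ∘ₗ (σ.lift f + σ.lift f') = (f + f') ∘ₗ σ.π M := by
      rw [LinearMap.comp_add, LinearMap.add_comp, σ.lift_spec, σ.lift_spec]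
    rw [← Submodule.Quotient.mk_add]
    exact (Submodule.Quotient.eq _).2 (σ.restrict_sub_mem (σ.lift_spec _) h)
  map_smul' r f := by
    have h : σ.π N ∘ₗ (r • σ.lift f) = (r • f) ∘ₗ σ.π M := by
      rw [LinearMap.comp_smul, LinearMap.smul_comp, σ.lift_spec]
    rw [RingHom.id_apply, ← Submodule.Quotient.mk_smul]
    exact (Submodule.Quotient.eq _).2 (σ.restrict_sub_mem (σ.lift_spec _) h)

theorem projectiveMaps_le_ker (M N : FGModuleCat.{u} R) :
    projectiveMaps R M N ≤ LinearMap.ker (σ.syzygyMapAux M N) := by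
  rintro f ⟨Q, _, _, _, p, q, rfl⟩
  obtain ⟨q', hq'⟩ := Module.projective_lifting_property (σ.π N) q (σ.surjective N)
  have h : σ.π N ∘ₗ (q' ∘ₗ p ∘ₗ σ.π M) = (q ∘ₗ p) ∘ₗ σ.π M := by
    rw [← LinearMap.comp_assoc, hq', LinearMap.comp_assoc]
  have h0 : (q' ∘ₗ p ∘ₗ σ.π M).restrict (σ.mapsTo_ker h) = 0 := by
    ext x
    have hx : σ.π M x = 0 := x.2
    simp [hx]
  have h1 := σ.restrict_sub_mem (σ.lift_spec (q ∘ₗ p)) h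
  rw [h0] at h1
  exact LinearMap.mem_ker.2 ((Submodule.Quotient.eq _).2 h1)

variable [IsNoetherianRing R]

/-- The syzygy `Ω M`: the kernel of the chosen surjection `P M → M`. -/
noncomputable def syzygy (M : FGModuleCat.{u} R) : FGModuleCat.{u} R :=
  FGModuleCat.of R (LinearMap.ker (σ.π M))

/-- The action of the syzygy functor on stable Hom modules: the class of `f` goes to the class of
the map that a lift of `f` induces on the syzygies. -/
noncomputable def syzygyMap (M N : FGModuleCat.{u} R) :
    StableHom R M N →ₗ[R] StableHom R (σ.syzygy M) (σ.syzygy N) :=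
  (projectiveMaps R M N).liftQ (σ.syzygyMapAux M N) (σ.projectiveMaps_le_ker M N)

/-- The iterated syzygy `Ω^n M`. -/
noncomputable def iterSyzygy : ℕ → FGModuleCat.{u} R → FGModuleCat.{u} R
  | 0, M => M
  | n + 1, M => σ.syzygy (iterSyzygy n M)

/-- The map that `Ω^n` induces on stable Hom modules. -/
noncomputable def iterSyzygyMap : (n : ℕ) → (M N : FGModuleCat.{u} R) →
    StableHom R M N →ₗ[R] StableHom R (σ.iterSyzygy n M) (σ.iterSyzygy n N)
  | 0, _, _ => LinearMap.id
  | n + 1, M, N =>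
    σ.syzygyMap (σ.iterSyzygy n M) (σ.iterSyzygy n N) ∘ₗ iterSyzygyMap n M N

/-- `V_n(M, N)`: the kernel of `Hom(M, N) → stable Hom(M, N) → stable Hom(Ω^n M, Ω^n N)`. -/
noncomputable def V (n : ℕ) (M N : FGModuleCat.{u} R) : Submodule R (M →ₗ[R] N) :=
  LinearMap.ker (σ.iterSyzygyMap n M N ∘ₗ (projectiveMaps R M N).mkQ)

end SyzygyChoice

variable {R : Type u} [CommRing R] [IsLocalRing R] [IsNoetherianRing R]

/-- The residue field, as a finitely generated module. -/
noncomputable abbrev residueModule (R : Type u) [CommRing R] [IsLocalRing R] : FGModuleCat.{u} R :=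
  FGModuleCat.of R (IsLocalRing.ResidueField R)

/-- `V_n(M) = V_n(M, k)` as a `k`-subspace of `Hom_R(M, k)`, where `k` is the residue field. -/
noncomputable def residueV (σ : SyzygyChoice R) (n : ℕ) (M : Type u) [AddCommGroup M]
    [Module R M] [Module.Finite R M] :
    Submodule (IsLocalRing.ResidueField R) (M →ₗ[R] IsLocalRing.ResidueField R) where
  carrier := {f | f ∈ σ.V n (FGModuleCat.of R M) (residueModule R)}
  zero_mem' := (σ.V n (FGModuleCat.of R M) (residueModule R)).zero_mem
  add_mem' := (σ.V n (FGModuleCat.of R M) (residueModule R)).add_mem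
  smul_mem' := by
    intro c f hf
    obtain ⟨r, rfl⟩ := IsLocalRing.residue_surjective c
    have h := (σ.V n (FGModuleCat.of R M) (residueModule R)).smul_mem r hf
    have e : IsLocalRing.residue R r • f = r • f := by
      ext x
      simp [Algebra.smul_def]
    rw [e]
    exact h

/-- The `n`-th approximated `ξ`-invariant `ξ_R(n, M) = dim_k V_n(M)`. It is a dimension of a
subspace of the finite-dimensional space `Hom_R(M, k)`. -/
noncomputable def xi (σ : SyzygyChoice R) (n : ℕ) (M : Type u) [AddCommGroup M]
    [Module R M] [Module.Finite R M] : ℕ :=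
  Module.finrank (IsLocalRing.ResidueField R) (residueV σ n M)

/-- `r` is the rank of the largest free direct summand of `M`. -/
def IsRankOfLargestFreeSummand (R : Type u) [CommRing R] (M : Type u) [AddCommGroup M] [Module R M]
    (r : ℕ) : Prop :=
  IsGreatest {s : ℕ | ∃ X F : Submodule R M, IsCompl X F ∧ Module.Free R F ∧
    Module.finrank R F = s} r

end StableXi

/-! Dimension shifting embeds `Ext¹(Ω^j M, R)` in `Ext^(j+1)(M, R)`. When the former vanishes, maps
from `Ω^(j+1) M` to finite free modules extend over the chosen projective cover of `Ω^j M`, which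
makes `Ω` injective on stable Hom out of `Ω^j M` (`syzygyMap_injective`). The kernels defining `ξ(j,
M)` and `ξ(j+1, M)` then coincide, which gives (1) and reduces (2) to `j = 0`. At `j = 0` the kernel
consists of the maps `M → k` that lift to `M → R`. By Nakayama, lifts of `r` independent ones form a
surjection `M → R^r`, which splits; conversely, the coordinates of a free summand have independent
reductions. -/

namespace StableXi

open CategoryTheory CategoryTheory.Abelian

/-! ### Dimension shifting and extension of maps -/

section Ext

variable {R : Type u} [CommRing R] {P X : Type u} [AddCommGroup P] [Module R P]
  [AddCommGroup X] [Module R X]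

/-- Dimension shifting along a surjection from a projective module. -/
theorem subsingleton_ext_ker [Module.Projective R P] {π : P →ₗ[R] X} (hπ : Function.Surjective π)
    (Y : ModuleCat.{u} R) (i : ℕ) (h : Subsingleton (Ext (ModuleCat.of R X) Y (i + 2))) :
    Subsingleton (Ext (ModuleCat.of R (LinearMap.ker π)) Y (i + 1)) := by
  have hS := LinearMap.shortExact_shortComplexKer hπ
  refine subsingleton_of_forall_eq 0 fun x => ?_
  obtain ⟨y, rfl⟩ := Ext.contravariant_sequence_exact₁ hS Y x (n₁ := i + 2) (by omega)
    (h.elim _ _)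
  -- The class lifts to `Ext^(i+1)(P, Y)`, which is zero because the degree is positive.
  have : Projective (π.shortComplexKer.X₂) :=
    inferInstanceAs (Projective (ModuleCat.of R P))
  rw [Ext.eq_zero_of_projective y, Ext.comp_zero]

/-- If `Ext¹(X, Y) = 0`, then maps from the kernel of `P → X` to `Y` extend to `P`. -/
theorem exists_extend_of_subsingleton_ext {π : P →ₗ[R] X} (hπ : Function.Surjective π)
    {Y : Type u} [AddCommGroup Y] [Module R Y]
    (h : Subsingleton (Ext (ModuleCat.of R X) (ModuleCat.of R Y) 1))
    (φ : LinearMap.ker π →ₗ[R] Y) :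
    ∃ ψ : P →ₗ[R] Y, ψ ∘ₗ (LinearMap.ker π).subtype = φ := by
  have hS := LinearMap.shortExact_shortComplexKer hπ
  obtain ⟨y, hy⟩ := Ext.contravariant_sequence_exact₁ hS (ModuleCat.of R Y)
    (Ext.mk₀ (ModuleCat.ofHom φ)) (n₁ := 1) (by omega) (h.elim _ _)
  obtain ⟨g, rfl⟩ := (Ext.mk₀_bijective _ _).2 y
  rw [Ext.mk₀_comp_mk₀] at hy
  have := (Ext.mk₀_bijective _ _).1 hy
  exact ⟨g.hom, congrArg ModuleCat.Hom.hom this⟩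

end Ext

/-- A map to a finitely generated module that factors through a projective module factors through
a finite free one. -/
theorem exists_factor_finite_free {R : Type u} [CommRing R] {X Y : Type u} [AddCommGroup X]
    [Module R X] [AddCommGroup Y] [Module R Y] {f : X →ₗ[R] Y} (hf : f ∈ projectiveMaps R X Y)
    {n : ℕ} {e : (Fin n → R) →ₗ[R] Y} (he : Function.Surjective e) :
    ∃ p : X →ₗ[R] (Fin n → R), e ∘ₗ p = f := by
  obtain ⟨Q, _, _, _, p, q, rfl⟩ := hf
  obtain ⟨q', rfl⟩ := Module.projective_lifting_property e q he
  exact ⟨q' ∘ₗ p, rfl⟩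

/-! ### Injectivity of the syzygy map on stable Hom -/

namespace SyzygyChoice

variable {R : Type u} [CommRing R] [IsNoetherianRing R] (σ : SyzygyChoice R)

theorem syzygyMap_injective (X Y : FGModuleCat.{u} R)
    (h : Subsingleton (Ext (ModuleCat.of R X) (ModuleCat.of R R) 1)) :
    Function.Injective (σ.syzygyMap X Y) := by
  rw [injective_iff_map_eq_zero]
  intro x hx
  obtain ⟨f, rfl⟩ := Submodule.Quotient.mk_surjective _ x
  have hmem : (σ.lift f).restrict (σ.mapsTo_ker (σ.lift_spec f)) ∈
      projectiveMaps R (LinearMap.ker (σ.π X)) (LinearMap.ker (σ.π Y)) :=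
    (Submodule.Quotient.mk_eq_zero _).1 hx
  obtain ⟨n, e, he⟩ := Module.Finite.exists_fin' R (LinearMap.ker (σ.π Y))
  obtain ⟨p, hp⟩ := exists_factor_finite_free hmem he
  have := σ.projective X
  choose ψ hψ using fun i =>
    exists_extend_of_subsingleton_ext (σ.surjective X) h (LinearMap.proj i ∘ₗ p)
  -- This map agrees with the lift of `f` on `ΩX` and takes values in `ΩY`. Subtracting it from the
  -- lift gives another lift of `f`, now zero on `ΩX`.
  let s : σ.P X →ₗ[R] σ.P Y := (LinearMap.ker (σ.π Y)).subtype ∘ₗ e ∘ₗ LinearMap.pi ψ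
  have hs : ∀ z : LinearMap.ker (σ.π X), s z = σ.lift f z := by
    intro z
    have h1 : LinearMap.pi ψ (z : σ.P X) = p z := by
      ext i
      exact LinearMap.congr_fun (hψ i) z
    have h2 := congrArg Subtype.val (LinearMap.congr_fun hp z)
    simp only [s, LinearMap.comp_apply, h1]
    exact h2
  have hle : LinearMap.ker (σ.π X) ≤ LinearMap.ker (σ.lift f - s) := by
    intro z hz
    rw [LinearMap.mem_ker, LinearMap.sub_apply, hs ⟨z, hz⟩, sub_self]
  -- The corrected lift descends to `X ≅ P X / ΩX`, so `f` factors through `P Y`.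
  refine (Submodule.Quotient.mk_eq_zero _).2 ⟨σ.P Y, inferInstance, inferInstance, σ.projective Y,
    (LinearMap.ker (σ.π X)).liftQ _ hle ∘ₗ
      ((σ.π X).quotKerEquivOfSurjective (σ.surjective X)).symm.toLinearMap, σ.π Y, ?_⟩
  ext x
  obtain ⟨y, rfl⟩ := σ.surjective X x
  have h1 : ((σ.π X).quotKerEquivOfSurjective (σ.surjective X)).symm (σ.π X y) =
      Submodule.Quotient.mk y := by
    rw [LinearEquiv.symm_apply_eq]
    rfl
  have h2 : σ.π Y (s y) = 0 := (e (LinearMap.pi ψ y)).2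
  have h3 := LinearMap.congr_fun (σ.lift_spec f) y
  simp only [LinearMap.comp_apply, LinearEquiv.coe_coe] at h3 ⊢
  rw [h1, Submodule.liftQ_apply, LinearMap.sub_apply, map_sub, h2, sub_zero, h3]

/-- Each syzygy trades one step of `j` for one degree of Ext, so `i` must vary in the induction. -/
theorem subsingleton_ext_iterSyzygy (X : FGModuleCat.{u} R) (Y : ModuleCat.{u} R) (j : ℕ) :
    ∀ i : ℕ, Subsingleton (Ext (ModuleCat.of R X) Y (i + j + 1)) →
      Subsingleton (Ext (ModuleCat.of R (σ.iterSyzygy j X)) Y (i + 1)) := by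
  induction j with
  | zero => exact fun i h => h
  | succ j ih =>
    intro i h
    have := σ.projective (σ.iterSyzygy j X)
    refine subsingleton_ext_ker (σ.surjective (σ.iterSyzygy j X)) Y i (ih (i + 1) ?_)
    rwa [show i + 1 + j + 1 = i + (j + 1) + 1 by omega]

theorem V_succ (X Y : FGModuleCat.{u} R) (j : ℕ)
    (h : Subsingleton (Ext (ModuleCat.of R X) (ModuleCat.of R R) (j + 1))) :
    σ.V (j + 1) X Y = σ.V j X Y := by
  have hinj := σ.syzygyMap_injective (σ.iterSyzygy j X) (σ.iterSyzygy j Y)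
    (σ.subsingleton_ext_iterSyzygy X _ j 0 (by rwa [zero_add]))
  exact LinearMap.ker_comp_of_ker_eq_bot (σ.iterSyzygyMap j X Y ∘ₗ (projectiveMaps R X Y).mkQ)
    (LinearMap.ker_eq_bot.2 hinj)

end SyzygyChoice

/-! ### Linear algebra over the residue field -/

/-- The dimension of a subspace is the largest size of a linearly independent family in it. -/
theorem exists_linearIndependent_mem_of_finrank {K V : Type*} [Field K] [AddCommGroup V]
    [Module K V] [Module.Finite K V] (W : Submodule K V) :
    ∃ v : Fin (Module.finrank K W) → V, (∀ i, v i ∈ W) ∧ LinearIndependent K v :=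
  ⟨fun i => Module.finBasis K W i, fun i => (Module.finBasis K W i).2,
    (Module.finBasis K W).linearIndependent.map' W.subtype W.ker_subtype⟩

theorem le_finrank_of_linearIndependent_mem {K V : Type*} [Field K] [AddCommGroup V]
    [Module K V] [Module.Finite K V] (W : Submodule K V) {n : ℕ} {v : Fin n → V}
    (hv : ∀ i, v i ∈ W) (h : LinearIndependent K v) : n ≤ Module.finrank K W := by
  have h' : LinearIndependent K fun i => (⟨v i, hv i⟩ : W) :=
    LinearIndependent.of_comp W.subtype h
  simpa using h'.fintype_card_le_finrank

/-- Functionals with linearly independent reductions are the coordinates of a surjection. -/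
theorem surjective_pi_of_linearIndependent_residue {R : Type*} [CommRing R] [IsLocalRing R]
    {M : Type*} [AddCommGroup M] [Module R M] {n : ℕ} (φ : Fin n → M →ₗ[R] R)
    (h : LinearIndependent (IsLocalRing.ResidueField R)
      fun i => Algebra.linearMap R (IsLocalRing.ResidueField R) ∘ₗ φ i) :
    Function.Surjective (LinearMap.pi φ) := by
  let W : Submodule (IsLocalRing.ResidueField R) (Fin n → IsLocalRing.ResidueField R) :=
    { carrier := Set.range fun x i => IsLocalRing.residue R (φ i x)
      zero_mem' := ⟨0, by ext; simp⟩
      add_mem' := by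
        rintro _ _ ⟨x, rfl⟩ ⟨y, rfl⟩
        exact ⟨x + y, by ext; simp⟩
      smul_mem' := by
        rintro c _ ⟨x, rfl⟩
        obtain ⟨r, rfl⟩ := IsLocalRing.residue_surjective c
        exact ⟨r • x, by ext; simp⟩ }
  have hW : W = ⊤ := by
    by_contra hne
    -- A nonzero functional vanishing on `W` is a nontrivial linear relation among the reductions,
    -- with coefficients its values on the standard basis.
    obtain ⟨g, hg, hg'⟩ := Submodule.exists_le_ker_of_lt_top W (lt_top_iff_ne_top.2 hne)
    refine hg (LinearMap.pi_ext' fun i => LinearMap.ext_ring ?_)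
    refine (Fintype.linearIndependent_iff.1 h) (fun i => g (Pi.single i 1)) ?_ i
    ext x
    have := hg' (show (fun i => IsLocalRing.residue R (φ i x)) ∈ W from ⟨x, rfl⟩)
    have e : ∀ i : Fin n, (fun j => if i = j then 1 else 0) =
        (Pi.single i 1 : Fin n → IsLocalRing.ResidueField R) := fun i => by
      ext j
      simp [Pi.single_apply, eq_comm]
    rw [LinearMap.mem_ker, LinearMap.pi_apply_eq_sum_univ] at this
    simp only [e] at this
    simpa [mul_comm] using this
  rw [← LinearMap.range_eq_top, ← top_le_iff]
  -- Nakayama: it suffices that the range and `𝔪 R^n` together span `R^n`.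
  refine Submodule.le_of_le_smul_of_le_jacobson_bot (I := IsLocalRing.maximalIdeal R)
    Module.Finite.fg_top (IsLocalRing.maximalIdeal_le_jacobson _) fun y _ => ?_
  obtain ⟨x, hx⟩ : (fun i => IsLocalRing.residue R (y i)) ∈ W := hW ▸ Submodule.mem_top
  rw [← add_sub_cancel (LinearMap.pi φ x) y]
  refine Submodule.add_mem_sup ⟨x, rfl⟩ ?_
  rw [pi_eq_sum_univ (y - LinearMap.pi φ x)]
  refine Submodule.sum_mem _ fun i _ => Submodule.smul_mem_smul ?_ Submodule.mem_top
  rw [← IsLocalRing.residue_eq_zero_iff, Pi.sub_apply, map_sub, sub_eq_zero]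
  exact (congrFun hx i).symm

/-! ### The invariant and free summands -/

variable {R : Type u} [CommRing R] [IsLocalRing R] [IsNoetherianRing R]
  (σ : SyzygyChoice R) (M : Type u) [AddCommGroup M] [Module R M] [Module.Finite R M]

theorem xi_succ (j : ℕ)
    (h : Subsingleton (Ext (ModuleCat.of R M) (ModuleCat.of R R) (j + 1))) :
    xi σ (j + 1) M = xi σ j M := by
  have : residueV σ (j + 1) M = residueV σ j M := by
    ext f
    change f ∈ σ.V (j + 1) (FGModuleCat.of R M) (residueModule R) ↔
      f ∈ σ.V j (FGModuleCat.of R M) (residueModule R)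
    rw [σ.V_succ (FGModuleCat.of R M) (residueModule R) j h]
  unfold xi
  rw [this]

theorem xi_eq_of_le {c j : ℕ} (hcj : c ≤ j)
    (h : ∀ i, c < i → i ≤ j → Subsingleton (Ext (ModuleCat.of R M) (ModuleCat.of R R) i)) :
    xi σ j M = xi σ c M := by
  induction j, hcj using Nat.le_induction with
  | base => rfl
  | succ j hcj ih =>
    rw [xi_succ σ M j (h _ (by omega) le_rfl), ih fun i h1 h2 => h i h1 (by omega)]

/-- Since `R → k` is onto, any map from a projective module to `k` lifts to `R`. -/
theorem mem_residueV_zero {f : M →ₗ[R] IsLocalRing.ResidueField R} :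
    f ∈ residueV σ 0 M ↔
      ∃ φ : M →ₗ[R] R, Algebra.linearMap R (IsLocalRing.ResidueField R) ∘ₗ φ = f := by
  have h0 : f ∈ residueV σ 0 M ↔ f ∈ projectiveMaps R M (IsLocalRing.ResidueField R) := by
    change f ∈ LinearMap.ker (LinearMap.id ∘ₗ
      (projectiveMaps R M (IsLocalRing.ResidueField R)).mkQ) ↔ _
    rw [LinearMap.id_comp, Submodule.ker_mkQ]
  rw [h0]
  constructor
  · rintro ⟨Q, _, _, _, p, q, rfl⟩
    obtain ⟨q', rfl⟩ := Module.projective_lifting_property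
      (Algebra.linearMap R (IsLocalRing.ResidueField R)) q IsLocalRing.residue_surjective
    exact ⟨q' ∘ₗ p, rfl⟩
  · rintro ⟨φ, rfl⟩
    exact ⟨R, inferInstance, inferInstance, inferInstance, φ, _, rfl⟩

instance : IsScalarTower R (IsLocalRing.ResidueField R) (M →ₗ[R] IsLocalRing.ResidueField R) :=
  ⟨fun r c f => by ext x; simp⟩

instance finite_hom_residueField :
    Module.Finite (IsLocalRing.ResidueField R) (M →ₗ[R] IsLocalRing.ResidueField R) :=
  Module.Finite.of_restrictScalars_finite R _ _

theorem isRankOfLargestFreeSummand_xi_zero : IsRankOfLargestFreeSummand R M (xi σ 0 M) := by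
  constructor
  · obtain ⟨f, hf, hli⟩ := exists_linearIndependent_mem_of_finrank (residueV σ 0 M)
    choose φ hφ using fun i => (mem_residueV_zero σ M).1 (hf i)
    obtain rfl : (fun i => Algebra.linearMap R (IsLocalRing.ResidueField R) ∘ₗ φ i) = f :=
      funext hφ
    obtain ⟨s, hs⟩ := LinearMap.exists_rightInverse_of_surjective (LinearMap.pi φ)
      (LinearMap.range_eq_top.2 (surjective_pi_of_linearIndependent_residue φ hli))
    have hinv : Function.LeftInverse (LinearMap.pi φ) s := LinearMap.congr_fun hs
    let e := LinearEquiv.ofInjective s hinv.injective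
    refine ⟨LinearMap.ker (LinearMap.pi φ), LinearMap.range s, ?_, Module.Free.of_equiv e, ?_⟩
    · refine ⟨Submodule.disjoint_def.2 ?_, codisjoint_iff_le_sup.2 fun x _ => ?_⟩
      · rintro _ hx ⟨y, rfl⟩
        rw [LinearMap.mem_ker, hinv y] at hx
        rw [hx, map_zero]
      · rw [← sub_add_cancel x (s (LinearMap.pi φ x))]
        refine Submodule.add_mem_sup ?_ ⟨_, rfl⟩
        rw [LinearMap.mem_ker, map_sub, hinv, sub_self]
    · rw [← e.finrank_eq, Module.finrank_fin_fun]
      rfl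
  · rintro _ ⟨X, F, hXF, hF, rfl⟩
    let p := Submodule.projectionOnto F X hXF.symm
    let b := Module.finBasis R F
    refine le_finrank_of_linearIndependent_mem (residueV σ 0 M)
      (v := fun i => Algebra.linearMap R (IsLocalRing.ResidueField R) ∘ₗ b.coord i ∘ₗ p)
      (fun i => (mem_residueV_zero σ M).2 ⟨_, rfl⟩) ?_
    rw [Fintype.linearIndependent_iff]
    intro c hc i
    -- Evaluating the relation at a basis vector of `F` isolates one coefficient.
    have h1 := LinearMap.congr_fun hc (b i : M)
    have h2 : p (b i : M) = b i := Submodule.projectionOnto_apply_left _ _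
    simpa [h2, Finsupp.single_apply] using h1

end StableXi

theorem corollary4p11 {R : Type u} [CommRing R] [IsLocalRing R] [IsNoetherianRing R]
    (σ : StableXi.SyzygyChoice R) (M : Type u) [AddCommGroup M] [Module R M]
    [Module.Finite R M] (n : ℕ) :
    (∀ a b : ℕ, 0 < a → a ≤ b →
      (∀ i : ℕ, a ≤ i → i ≤ b →
        Subsingleton (CategoryTheory.Abelian.Ext (ModuleCat.of R M) (ModuleCat.of R R) i)) →
      ∀ j : ℕ, a - 1 ≤ j → j ≤ b → StableXi.xi σ j M = StableXi.xi σ (a - 1) M) ∧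
    ((∀ i : ℕ, 1 ≤ i → i ≤ n →
        Subsingleton (CategoryTheory.Abelian.Ext (ModuleCat.of R M) (ModuleCat.of R R) i)) →
      ∀ j : ℕ, j ≤ n →
        StableXi.IsRankOfLargestFreeSummand R M (StableXi.xi σ j M)) := by
  refine ⟨fun a b ha _ h j hj hjb => ?_, fun h j hj => ?_⟩
  -- As `0 < a`, the condition `a - 1 < i` is `a ≤ i`.
  · exact StableXi.xi_eq_of_le σ M hj fun i h1 h2 => h i (by omega) (by omega)
  · rw [StableXi.xi_eq_of_le σ M (Nat.zero_le j) fun i h1 h2 => h i h1 (by omega)]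
    exact StableXi.isRankOfLargestFreeSummand_xi_zero σ M
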